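/- Let $L^2(\partial\mathbb D)$ be taken with respect to normalized arc length, and let $H^2\subset L^2(\partial\mathbb D)$ be the Hardy space of the unit disk $\mathbb D$, identified with its space of boundary functions. For a finite Blaschke product $$\alpha(z)=c\prod_{j=1}^{m}\frac{z-a_j}{1-\overline{a_j}z},\qquad |c|=1,\ |a_1|,\dots,|a_m|<1,$$ of degree $m$, let $K_\alpha=H^2\ominus\alpha H^2$ be the model space and let $P_\alpha$ be the orthogonal projection of $L^2(\partial\mathbb D)$ onto $K_\alpha$. For $w\in\overline{\mathbb D}$ let $$k_w^\alpha(z)=\frac{1-\overline{\alpha(w)}\,\alpha(z)}{1-\overline w z},\qquad \widetilde k_w^\alpha(z)=\frac{\alpha(z)-\alpha(w)}{z-w},$$ which are elements of $K_\alpha$. For finite Blaschke products $\alpha,\beta$ let $\mathscr T(\alpha,\beta)$ be the set of bounded operators $A\colon K_\alpha\to K_\beta$ for which there is a symbol $\varphi\in L^2(\partial\mathbb D)$ such that $Af=P_\beta(\varphi f)$ for all bounded $f\in K_\alpha$. For $g\in K_\beta$, $f\in K_\alpha$ let $(g\otimes f)(h)=\langle h,f\rangle g$. **Theorem.** Let $\alpha$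 and $\beta$ be finite Blaschke products of degree $m>0$ and $n>0$, respectively. The set of rank-one operators in $\mathscr T(\alpha,\beta)$ is equal to the set of all nonzero scalar multiples of the operators $\widetilde k_w^\beta\otimes k_w^\alpha$ and $k_w^\beta\otimes\widetilde k_w^\alpha$, $w\in\overline{\mathbb D}$, if and only if either $mn\le 2$, or both $m>1$ and $n>1$. -/

import Mathlib

open MeasureTheory AddCircle
open scoped ComplexConjugate Real

noncomputable section

namespace ModelSpace

instance fact_two_pi_pos : Fact ((0 : ℝ) < 2 * π) := ⟨Real.two_pi_pos⟩

/-- The parameter space of the unit circle: `t ∈ ℝ / 2πℤ` stands for the point `exp (i t)`. -/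
abbrev CircleParam : Type := AddCircle (2 * π)

/-- The point `exp (i t)` of the unit circle, as a complex number. -/
def circlePt (t : CircleParam) : ℂ := (AddCircle.toCircle t : ℂ)

/-- `L²` of the unit circle with respect to normalized arc length. -/
abbrev L2Circle : Type := Lp ℂ 2 (haarAddCircle : Measure CircleParam)

/-- `α` coincides on the closed unit disk with
`c * ∏ j, (z - a j) / (1 - conj (a j) * z)`, where `|c| = 1` and `|a j| < 1`, `j = 1, …, m`:
it is a finite Blaschke product of degree `m`. -/
def IsFiniteBlaschkeProduct (α : ℂ → ℂ) (m : ℕ) : Prop :=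
  ∃ (c : ℂ) (a : Fin m → ℂ), ‖c‖ = 1 ∧ (∀ j, ‖a j‖ < 1) ∧
    ∀ z : ℂ, ‖z‖ ≤ 1 → α z = c * ∏ j, (z - a j) / (1 - conj (a j) * z)

theorem fourierCoeff_eq_inner (f : L2Circle) (n : ℤ) :
    fourierCoeff (f : CircleParam → ℂ) n = inner ℂ (fourierBasis n : L2Circle) f := by
  rw [← fourierBasis_repr, HilbertBasis.repr_apply_apply]

/-- The Hardy space `H²`, through boundary values: the functions in `L²` of the circle
whose Fourier coefficients of negative index vanish. -/
def hardy : Submodule ℂ L2Circle where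
  carrier := {f | ∀ n : ℤ, n < 0 → fourierCoeff (f : CircleParam → ℂ) n = 0}
  zero_mem' := by
    intro n _
    rw [fourierCoeff_eq_inner, inner_zero_right]
  add_mem' := by
    intro f g hf hg n hn
    have hf' := hf n hn
    have hg' := hg n hn
    rw [fourierCoeff_eq_inner] at hf' hg' ⊢
    rw [inner_add_right, hf', hg', add_zero]
  smul_mem' := by
    intro c f hf n hn
    have hf' := hf n hn
    rw [fourierCoeff_eq_inner] at hf' ⊢
    rw [inner_smul_right, hf', mul_zero]

theorem isClosed_hardy : IsClosed (hardy : Set L2Circle) := by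
  have h : (hardy : Set L2Circle) =
      ⋂ n : ℤ, ⋂ _ : n < 0, {f : L2Circle | inner ℂ (fourierBasis n : L2Circle) f = 0} := by
    ext f
    simp only [Set.mem_iInter, Set.mem_ofPred_eq, ← fourierCoeff_eq_inner]
    rfl
  rw [h]
  exact isClosed_iInter fun n => isClosed_iInter fun _ =>
    isClosed_eq (continuous_const.inner continuous_id) continuous_const

/-- The subspace `α H²`, i.e. all elements of `L²` of the form `α h` with `h ∈ H²`. -/
def mulHardy (α : ℂ → ℂ) : Submodule ℂ L2Circle where
  carrier := {g | ∃ h ∈ hardy, ∀ᵐ t ∂(haarAddCircle : Measure CircleParam),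
    g t = α (circlePt t) * h t}
  zero_mem' := by
    refine ⟨0, hardy.zero_mem, ?_⟩
    filter_upwards [Lp.coeFn_zero ℂ 2 (haarAddCircle : Measure CircleParam)] with t ht
    rw [ht]; simp
  add_mem' := by
    rintro g₁ g₂ ⟨h₁, hh₁, e₁⟩ ⟨h₂, hh₂, e₂⟩
    refine ⟨h₁ + h₂, hardy.add_mem hh₁ hh₂, ?_⟩
    filter_upwards [e₁, e₂, Lp.coeFn_add g₁ g₂, Lp.coeFn_add h₁ h₂] with t a b c d
    rw [c, d, Pi.add_apply, Pi.add_apply, a, b, mul_add]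
  smul_mem' := by
    rintro r g ⟨h, hh, e⟩
    refine ⟨r • h, hardy.smul_mem r hh, ?_⟩
    filter_upwards [e, Lp.coeFn_smul r g, Lp.coeFn_smul r h] with t a c d
    rw [c, d, Pi.smul_apply, Pi.smul_apply, a, smul_eq_mul, smul_eq_mul, mul_left_comm]

/-- The model space `K_α = H² ⊖ α H²`. -/
def model (α : ℂ → ℂ) : Submodule ℂ L2Circle := hardy ⊓ (mulHardy α)ᗮ

instance completeSpace_model (α : ℂ → ℂ) : CompleteSpace (model α) :=
  (isClosed_hardy.inter (Submodule.isClosed_orthogonal (mulHardy α))).completeSpace_coe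

/-- `f ∈ K_α` is the kernel function `k_w^α (z) = (1 - conj (α w) α z) / (1 - conj w z)`.
(For `|w| = 1` the quotient is not given by the formula at the single point `z = w`,
which is a null set.) -/
def IsKernel (α : ℂ → ℂ) (w : ℂ) (f : model α) : Prop :=
  ∀ᵐ t ∂(haarAddCircle : Measure CircleParam), (f : L2Circle) t =
    (1 - conj (α w) * α (circlePt t)) / (1 - conj w * circlePt t)

/-- `f ∈ K_α` is the conjugate kernel function `(α z - α w) / (z - w)`. -/
def IsConjKernel (α : ℂ → ℂ) (w : ℂ) (f : model α) : Prop :=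
  ∀ᵐ t ∂(haarAddCircle : Measure CircleParam), (f : L2Circle) t =
    (α (circlePt t) - α w) / (circlePt t - w)

/-- The set `𝒯(α, β)` of bounded operators `A : K_α → K_β` for which there is a symbol
`φ ∈ L²` with `A f = P_β (φ f)` for all bounded functions `f ∈ K_α`. -/
def asymTruncToeplitz (α β : ℂ → ℂ) : Set (model α →L[ℂ] model β) :=
  {A | ∃ φ : L2Circle, ∀ f : model α,
    MemLp ((f : L2Circle) : CircleParam → ℂ) ⊤ (haarAddCircle : Measure CircleParam) →
      ∃ h : L2Circle,
        (∀ᵐ t ∂(haarAddCircle : Measure CircleParam), h t = φ t * (f : L2Circle) t) ∧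
        A f = (model β).orthogonalProjectionOnto h}

/-- The operators of rank one in `𝒯(α, β)`. -/
def rankOneToeplitz (α β : ℂ → ℂ) : Set (model α →L[ℂ] model β) :=
  {A | A ∈ asymTruncToeplitz α β ∧ Module.finrank ℂ (LinearMap.range A.toLinearMap) = 1}

/-- The nonzero scalar multiples of the operators `k̃_w^β ⊗ k_w^α` and `k_w^β ⊗ k̃_w^α`,
`|w| ≤ 1`, where `(g ⊗ f) h = ⟨h, f⟩ g`. -/
def kernelTensors (α β : ℂ → ℂ) : Set (model α →L[ℂ] model β) :=
  {A | ∃ w : ℂ, ‖w‖ ≤ 1 ∧ ∃ c : ℂ, c ≠ 0 ∧ ∃ (f : model α) (g : model β),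
    ((IsConjKernel β w g ∧ IsKernel α w f) ∨ (IsKernel β w g ∧ IsConjKernel α w f)) ∧
    A = c • InnerProductSpace.rankOne ℂ g f}

end ModelSpace

end

/-! With `D = ∏ (1 - conj (a j) z)`, the model space of a Blaschke product of degree `m` has the
basis `z ^ i / D`, `i < m`. Take the matrix of an operator from `K_α` to `K_β` in these bases, with
the basis of `K_β` reversed. On the circle `conj z = z⁻¹`, so the product of a basis function with
the conjugate of a reversed one is `z ^ (i + j)` times a fixed invertible weight
(`star_bas_rev_mul_bas`). Hence a symbol produces a matrix depending only on `i + j`, and a suitable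
trigonometric polynomial divided by the weight realizes any prescribed sequence: `𝒯(α, β)` is
exactly the space of `m × n` Hankel matrices (`mem_asymTruncToeplitz_iff`).

Pairing the basis with a kernel function at `w` gives a geometric progression of ratio `w`, and the
conjugate kernel gives the same after reversal (`exists_kernels`). Thus the kernel tensors are the
Hankel matrices `C w ^ (i + j)` with `|w| ≤ 1` and their reflections `C w ^ (N - i - j)`, where `N =
m + n - 2` (`mem_kernelTensors_iff`). By inversion `w ↦ w⁻¹` these are together all nonzero
multiples of evaluations at points of the Riemann sphere on polynomials of degree at most `N`.

What remains is linear algebra. If `m, n > 1`, vanishing `2 × 2` minors force a rank-one Hankel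
matrix to be a point evaluation (`isPointEval_of_hankel`). If one size is `1`, every nonzero
sequence has rank one; it must be a point evaluation when `N ≤ 1`, whereas `0, 1, 0, …` is not one
when `N ≥ 2`. -/

noncomputable section

namespace ModelSpace

/-! ### Multiplication by continuous functions, and means. -/

/-- A continuous function on the circle as an element of `L²`. -/
def ofCont : C(CircleParam, ℂ) →L[ℂ] L2Circle :=
  ContinuousMap.toLp 2 (haarAddCircle : Measure CircleParam) ℂ

theorem coeFn_ofCont (φ : C(CircleParam, ℂ)) :
    (ofCont φ : CircleParam → ℂ) =ᵐ[haarAddCircle] φ :=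
  ContinuousMap.coeFn_toLp _ φ

theorem ofCont_injective : Function.Injective ofCont :=
  ContinuousMap.toLp_injective _

/-- Multiplication by a continuous function on `L²` of the circle. -/
def mulL (φ : C(CircleParam, ℂ)) : L2Circle →L[ℂ] L2Circle :=
  (ContinuousLinearMap.mul ℂ ℂ).holderL (haarAddCircle : Measure CircleParam) ⊤ 2 2
    (ContinuousMap.toLp ⊤ (haarAddCircle : Measure CircleParam) ℂ φ)

theorem coeFn_mulL (φ : C(CircleParam, ℂ)) (f : L2Circle) :
    (mulL φ f : CircleParam → ℂ) =ᵐ[haarAddCircle] fun t => φ t * f t := by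
  have h := (ContinuousLinearMap.mul ℂ ℂ).coeFn_holder (r := 2)
    (ContinuousMap.toLp ⊤ (haarAddCircle : Measure CircleParam) ℂ φ) f
  filter_upwards [h, ContinuousMap.coeFn_toLp (p := ⊤) (𝕜 := ℂ)
    (haarAddCircle : Measure CircleParam) φ] with t h₁ h₂
  rw [← h₂]
  exact h₁

theorem mulL_mul (φ ψ : C(CircleParam, ℂ)) (f : L2Circle) :
    mulL (φ * ψ) f = mulL φ (mulL ψ f) := by
  apply Lp.ext
  filter_upwards [coeFn_mulL (φ * ψ) f, coeFn_mulL φ (mulL ψ f), coeFn_mulL ψ f] with t h₁ h₂ h₃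
  rw [h₁, h₂, h₃, ContinuousMap.mul_apply, mul_assoc]

theorem mulL_one (f : L2Circle) : mulL 1 f = f := by
  apply Lp.ext
  filter_upwards [coeFn_mulL 1 f] with t h
  rw [h, ContinuousMap.one_apply, one_mul]

theorem mulL_sub (φ ψ : C(CircleParam, ℂ)) (f : L2Circle) :
    mulL (φ - ψ) f = mulL φ f - mulL ψ f := by
  simp [mulL]

theorem mulL_smul (c : ℂ) (φ : C(CircleParam, ℂ)) (f : L2Circle) :
    mulL (c • φ) f = c • mulL φ f := by
  simp [mulL]

theorem mulL_ofCont (φ ψ : C(CircleParam, ℂ)) : mulL φ (ofCont ψ) = ofCont (φ * ψ) := by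
  apply Lp.ext
  filter_upwards [coeFn_mulL φ (ofCont ψ), coeFn_ofCont ψ, coeFn_ofCont (φ * ψ)] with t h₁ h₂ h₃
  rw [h₁, h₂, h₃, ContinuousMap.mul_apply]

theorem inner_mulL (φ : C(CircleParam, ℂ)) (f g : L2Circle) :
    inner ℂ f (mulL φ g) = inner ℂ (mulL (star φ) f) g := by
  rw [L2.inner_def, L2.inner_def]
  apply integral_congr_ae
  filter_upwards [coeFn_mulL φ g, coeFn_mulL (star φ) f] with t h₁ h₂
  rw [h₁, h₂]
  simp only [RCLike.inner_apply, ContinuousMap.star_apply, map_mul, RCLike.star_def,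
    Complex.conj_conj]
  ring

/-- The integral of a continuous function on the circle. -/
def mean (φ : C(CircleParam, ℂ)) : ℂ := inner ℂ (ofCont 1) (ofCont φ)

theorem inner_ofCont_mulL (ψ φ : C(CircleParam, ℂ)) (f : L2Circle) :
    inner ℂ (ofCont ψ) (mulL φ f) = inner ℂ (ofCont 1) (mulL (star ψ * φ) f) := by
  rw [inner_mulL, inner_mulL, mulL_ofCont, mulL_ofCont, star_mul, star_star, mul_one]

theorem inner_ofCont (φ ψ : C(CircleParam, ℂ)) :
    inner ℂ (ofCont φ) (ofCont ψ) = mean (star φ * ψ) := by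
  have := inner_ofCont_mulL φ ψ (ofCont 1)
  rwa [mulL_ofCont, mulL_ofCont, mul_one, mul_one] at this

theorem mean_sub (φ ψ : C(CircleParam, ℂ)) : mean (φ - ψ) = mean φ - mean ψ := by
  rw [mean, map_sub, inner_sub_right]; rfl

theorem mean_smul (c : ℂ) (φ : C(CircleParam, ℂ)) : mean (c • φ) = c * mean φ := by
  rw [mean, map_smul, inner_smul_right]; rfl

theorem mean_sum {ι : Type*} (s : Finset ι) (φ : ι → C(CircleParam, ℂ)) :
    mean (∑ i ∈ s, φ i) = ∑ i ∈ s, mean (φ i) := by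
  rw [mean, map_sum, inner_sum]; rfl

theorem mean_star (φ : C(CircleParam, ℂ)) : mean (star φ) = conj (mean φ) := by
  have h := inner_ofCont φ 1
  rw [mul_one, ← inner_conj_symm] at h
  exact h.symm

/-! ### Fourier coefficients and the Hardy space. -/

/-- The coordinate function `z` of the circle. -/
abbrev zC : C(CircleParam, ℂ) := fourier 1

theorem zC_apply (t : CircleParam) : zC t = circlePt t := fourier_one

theorem zC_mul_star : zC * star zC = 1 := by
  ext t
  rw [ContinuousMap.mul_apply, ContinuousMap.star_apply, RCLike.star_def, ← fourier_neg,
    ← fourier_add]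
  simp

theorem norm_circlePt (t : CircleParam) : ‖circlePt t‖ = 1 := Circle.norm_coe _

theorem circlePt_mul_conj (t : CircleParam) : circlePt t * conj (circlePt t) = 1 := by
  rw [Complex.mul_conj, Complex.normSq_eq_norm_sq, norm_circlePt]; simp

theorem fourier_natCast (k : ℕ) : (fourier (k : ℤ) : C(CircleParam, ℂ)) = zC ^ k := by
  induction k with
  | zero => ext t; simp
  | succ k ih =>
    ext t
    rw [pow_succ, ← ih, Nat.cast_succ, fourier_add]
    rfl

theorem star_fourier (k : ℤ) : star (fourier k : C(CircleParam, ℂ)) = fourier (-k) := by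
  ext t
  rw [ContinuousMap.star_apply, RCLike.star_def, fourier_neg]

theorem fourier_mul_fourier (k l : ℤ) :
    (fourier k * fourier l : C(CircleParam, ℂ)) = fourier (k + l) := by
  ext t
  rw [ContinuousMap.mul_apply, fourier_add]

theorem fourierBasis_eq (k : ℤ) : (fourierBasis k : L2Circle) = ofCont (fourier k) := by
  rw [coe_fourierBasis]; rfl

/-- The Fourier coefficient as an inner product. -/
def coef (k : ℤ) (f : L2Circle) : ℂ := inner ℂ (ofCont (fourier k)) f

theorem mem_hardy_iff (f : L2Circle) : f ∈ hardy ↔ ∀ k : ℤ, k < 0 → coef k f = 0 := by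
  have : f ∈ hardy ↔ ∀ n : ℤ, n < 0 → fourierCoeff (f : CircleParam → ℂ) n = 0 := Iff.rfl
  rw [this]
  simp only [fourierCoeff_eq_inner, fourierBasis_eq, coef]

theorem coef_mulL_fourier (k l : ℤ) (f : L2Circle) :
    coef k (mulL (fourier l) f) = coef (k - l) f := by
  rw [coef, inner_mulL, mulL_ofCont, star_fourier, fourier_mul_fourier, coef, neg_add_eq_sub]

theorem coef_ofCont_fourier (k l : ℤ) : coef k (ofCont (fourier l)) = if k = l then 1 else 0 := by
  have h := (orthonormal_iff_ite.mp (orthonormal_fourier (T := 2 * π))) k l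
  exact h

theorem ext_coef {f g : L2Circle} (h : ∀ k, coef k f = coef k g) : f = g := by
  apply (fourierBasis (T := 2 * π)).repr.injective
  ext k
  rw [HilbertBasis.repr_apply_apply, HilbertBasis.repr_apply_apply, fourierBasis_eq]
  exact h k

theorem mean_fourier (k : ℤ) : mean (fourier k) = if k = 0 then 1 else 0 := by
  have h := coef_ofCont_fourier 0 k
  have h0 : (fourier 0 : C(CircleParam, ℂ)) = 1 := by ext t; simp
  rw [coef, h0] at h
  rw [mean, h]
  simp only [eq_comm]

theorem norm_coef_le (k : ℤ) (f : L2Circle) : ‖coef k f‖ ≤ ‖f‖ := by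
  refine (norm_inner_le_norm _ _).trans ?_
  have h : ‖ofCont (fourier k)‖ = 1 := (orthonormal_fourier (T := 2 * π)).1 k
  rw [h, one_mul]

/-- The polynomial `1 - conj a * z` on the circle. -/
def linC (a : ℂ) : C(CircleParam, ℂ) := 1 - conj a • zC

theorem coef_mulL_linC (a : ℂ) (k : ℤ) (f : L2Circle) :
    coef k (mulL (linC a) f) = coef k f - conj a * coef (k - 1) f := by
  rw [linC, mulL_sub, mulL_one, mulL_smul, coef, inner_sub_right, inner_smul_right,
    ← coef_mulL_fourier]
  rfl

/-- This allows division by `1 - conj a * z` inside `H²` using Fourier coefficients alone, with no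
analytic continuation into the disk. -/
theorem mulL_linC_mem_hardy_iff {a : ℂ} (ha : ‖a‖ < 1) (f : L2Circle) :
    mulL (linC a) f ∈ hardy ↔ f ∈ hardy := by
  rw [mem_hardy_iff, mem_hardy_iff]
  simp only [coef_mulL_linC]
  constructor
  · intro h k hk
    -- Iterating the recursion pushes a negative index towards `-∞`; the coefficients stay bounded
    -- by `‖f‖` while `‖a‖ ^ j` tends to zero.
    have step : ∀ j : ℕ, coef k f = conj a ^ j * coef (k - j) f := by
      intro j
      induction j with
      | zero => simp
      | succ j ih =>
        have h1 := h (k - j) (by omega)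
        rw [ih, sub_eq_zero.mp h1, pow_succ, mul_assoc]
        push_cast
        rw [sub_sub]
    have lim : Filter.Tendsto (fun j : ℕ => ‖a‖ ^ j * ‖f‖) Filter.atTop (nhds (0 * ‖f‖)) :=
      (tendsto_pow_atTop_nhds_zero_of_lt_one (norm_nonneg a) ha).mul_const _
    rw [zero_mul] at lim
    refine norm_le_zero_iff.mp (ge_of_tendsto' lim fun j => ?_)
    rw [step j, norm_mul, norm_pow, RCLike.norm_conj]
    gcongr
    exact norm_coef_le _ _
  · intro h k hk
    rw [h k hk, h (k - 1) (by omega), mul_zero, sub_zero]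

theorem mulL_prod_linC_mem_hardy_iff {ι : Type*} (s : Finset ι) {a : ι → ℂ}
    (ha : ∀ j, ‖a j‖ < 1) (f : L2Circle) :
    mulL (∏ j ∈ s, linC (a j)) f ∈ hardy ↔ f ∈ hardy := by
  classical
  induction s using Finset.induction_on generalizing f with
  | empty => rw [Finset.prod_empty, mulL_one]
  | insert j s hj ih =>
    rw [Finset.prod_insert hj, mulL_mul, mulL_linC_mem_hardy_iff (ha j), ih]

theorem ofCont_pow_zC_mem_hardy (i : ℕ) : ofCont (zC ^ i) ∈ hardy := by
  rw [mem_hardy_iff]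
  intro k hk
  rw [← fourier_natCast, coef_ofCont_fourier, if_neg (by omega)]

/-- The mean of a function in `z H²` vanishes. -/
theorem inner_one_mulL_pow_zC {f : L2Circle} (hf : f ∈ hardy) {i : ℕ} (hi : 0 < i) :
    inner ℂ (ofCont 1) (mulL (zC ^ i) f) = 0 := by
  have h := coef_mulL_fourier 0 i f
  have h0 : (fourier 0 : C(CircleParam, ℂ)) = 1 := by ext t; simp
  rw [coef, h0, fourier_natCast] at h
  rw [h]
  exact (mem_hardy_iff f).mp hf _ (by omega)

theorem linC_apply (a : ℂ) (t : CircleParam) : linC a t = 1 - conj a * circlePt t := by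
  rw [linC, ContinuousMap.sub_apply, ContinuousMap.smul_apply, zC_apply]; rfl

theorem one_sub_conj_mul_ne_zero {a z : ℂ} (ha : ‖a‖ < 1) (hz : ‖z‖ ≤ 1) :
    1 - conj a * z ≠ 0 := by
  intro h
  have h1 : ‖conj a * z‖ = 1 := by rw [← sub_eq_zero.mp h, norm_one]
  rw [norm_mul, RCLike.norm_conj] at h1
  nlinarith [norm_nonneg a, norm_nonneg z]

/-! ### Blaschke products on the circle and the basis of the model space. -/

/-- A representation of `α` as a finite Blaschke product of degree `m`. -/
structure BlaschkeData (α : ℂ → ℂ) (m : ℕ) where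
  /-- the unimodular constant -/
  c : ℂ
  /-- the zeros -/
  a : Fin m → ℂ
  norm_c : ‖c‖ = 1
  norm_a : ∀ j, ‖a j‖ < 1
  eq : ∀ z : ℂ, ‖z‖ ≤ 1 → α z = c * ∏ j, (z - a j) / (1 - conj (a j) * z)

namespace BlaschkeData

variable {α : ℂ → ℂ} {m : ℕ} (B : BlaschkeData α m)

/-- The denominator `∏ (1 - conj (a j) z)` on the circle. -/
def den : C(CircleParam, ℂ) := ∏ j, linC (B.a j)

theorem den_apply (t : CircleParam) : B.den t = ∏ j, (1 - conj (B.a j) * circlePt t) := by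
  rw [den, ContinuousMap.prod_apply]
  exact Finset.prod_congr rfl fun j _ => linC_apply _ _

/-- The reciprocal of the denominator on the circle. -/
def denInv : C(CircleParam, ℂ) := Ring.inverse B.den

theorem den_mul_denInv : B.den * B.denInv = 1 := by
  apply Ring.mul_inverse_cancel
  rw [ContinuousMap.isUnit_iff_forall_ne_zero]
  intro t
  rw [den_apply]
  exact Finset.prod_ne_zero_iff.mpr fun j _ =>
    one_sub_conj_mul_ne_zero (B.norm_a j) (norm_circlePt t).le

theorem star_den_mul_star_denInv : star B.den * star B.denInv = 1 := by
  rw [← star_mul, mul_comm B.denInv, den_mul_denInv, star_one]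

theorem denInv_apply (t : CircleParam) : B.denInv t = (B.den t)⁻¹ := by
  have h : (B.den * B.denInv) t = 1 := by rw [den_mul_denInv]; rfl
  exact eq_inv_of_mul_eq_one_right h

/-- The Blaschke product on the circle. -/
def bl : C(CircleParam, ℂ) := B.c • (zC ^ m * star B.den * B.denInv)

/-- On the circle `z - a = z * conj (1 - conj a * z)`, so the numerator is `z ^ m` times the
conjugate denominator. -/
theorem bl_apply (t : CircleParam) : B.bl t = α (circlePt t) := by
  rw [B.eq _ (norm_circlePt t).le, bl, ContinuousMap.smul_apply, ContinuousMap.mul_apply,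
    ContinuousMap.mul_apply, ContinuousMap.pow_apply, zC_apply, denInv_apply,
    ContinuousMap.star_apply, den_apply, Finset.prod_div_distrib, div_eq_mul_inv, smul_eq_mul]
  congr 2
  rw [RCLike.star_def, map_prod, ← Fin.prod_const, ← Finset.prod_mul_distrib]
  refine Finset.prod_congr rfl fun j _ => ?_
  rw [map_sub, map_mul, map_one, Complex.conj_conj]
  linear_combination -(B.a j) * circlePt_mul_conj t

theorem conj_c_mul_c : conj B.c * B.c = 1 := by
  rw [mul_comm, Complex.mul_conj, Complex.normSq_eq_norm_sq, B.norm_c]; simp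

theorem c_ne_zero : B.c ≠ 0 := by
  rw [← norm_ne_zero_iff, B.norm_c]; exact one_ne_zero

theorem star_mul_zC_pow (i : ℕ) : star (zC ^ i) * zC ^ i = (1 : C(CircleParam, ℂ)) := by
  rw [star_pow, ← mul_pow, mul_comm (star zC), zC_mul_star, one_pow]

theorem star_bl_mul_bl : star B.bl * B.bl = 1 := by
  have h1 := star_mul_zC_pow m
  have h2 := B.den_mul_denInv
  have h3 := B.star_den_mul_star_denInv
  rw [bl, star_smul, star_mul, star_mul, star_star, smul_mul_smul_comm, RCLike.star_def,
    B.conj_c_mul_c, one_smul]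
  calc _ = (star (zC ^ m) * zC ^ m) * (B.den * B.denInv) * (star B.den * star B.denInv) := by ring
    _ = 1 := by rw [h1, h2, h3]; ring

/-- The basis functions `z ^ i / ∏ (1 - conj (a j) z)` of the model space. -/
def bas (i : ℕ) : C(CircleParam, ℂ) := zC ^ i * B.denInv

/-- The conjugate denominator in `bl` cancels that of the basis function. This symmetry yields both
orthogonality to `α H²` and the action of the conjugation on the basis. -/
theorem star_bas_mul_bl {i : ℕ} (hi : i ≤ m) :
    star (B.bas i) * B.bl = B.c • B.bas (m - i) := by
  have h1 := star_mul_zC_pow i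
  have h3 := B.star_den_mul_star_denInv
  obtain ⟨k, rfl⟩ := Nat.exists_eq_add_of_le hi
  rw [bas, bas, bl, star_mul, mul_smul_comm, Nat.add_sub_cancel_left]
  congr 1
  calc _ = (star (zC ^ i) * zC ^ i) * (star B.den * star B.denInv) * (zC ^ k * B.denInv) := by ring
    _ = _ := by rw [h1, h3]; ring

theorem mem_mulHardy_iff (g : L2Circle) : g ∈ mulHardy α ↔ ∃ h ∈ hardy, g = mulL B.bl h := by
  have key : ∀ h : L2Circle, g = mulL B.bl h ↔
      ∀ᵐ t ∂(haarAddCircle : Measure CircleParam), g t = α (circlePt t) * h t := by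
    intro h
    constructor
    · rintro rfl
      filter_upwards [coeFn_mulL B.bl h] with t ht
      rw [ht, bl_apply]
    · intro hg
      apply Lp.ext
      filter_upwards [coeFn_mulL B.bl h, hg] with t ht hg
      rw [ht, bl_apply, hg]
  simp only [key]
  rfl

theorem mulL_denInv_mem_hardy {f : L2Circle} (hf : f ∈ hardy) : mulL B.denInv f ∈ hardy := by
  rw [← mulL_prod_linC_mem_hardy_iff Finset.univ B.norm_a]
  change mulL B.den _ ∈ hardy
  rwa [← mulL_mul, den_mul_denInv, mulL_one]

theorem bas_mem_hardy (i : ℕ) : ofCont (B.bas i) ∈ hardy := by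
  rw [bas, mul_comm (zC ^ i), ← mulL_ofCont]
  exact B.mulL_denInv_mem_hardy (ofCont_pow_zC_mem_hardy i)

theorem mean_bas {i : ℕ} (hi : 0 < i) : mean (B.bas i) = 0 := by
  have h : ofCont B.denInv ∈ hardy := by simpa [bas] using B.bas_mem_hardy 0
  rw [mean, bas, ← mulL_ofCont]
  exact inner_one_mulL_pow_zC h hi

/-- Pairing with `α h` gives a multiple of the mean of `z ^ (m - i) * h / D`, which vanishes because
`m - i > 0`. -/
theorem bas_mem_model {i : ℕ} (hi : i < m) : ofCont (B.bas i) ∈ model α := by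
  refine ⟨B.bas_mem_hardy i, ?_⟩
  refine (Submodule.mem_orthogonal _ _).mpr ?_
  intro u hu
  obtain ⟨h, hh, rfl⟩ := (B.mem_mulHardy_iff u).mp hu
  rw [← inner_conj_symm, inner_ofCont_mulL, B.star_bas_mul_bl hi.le, mulL_smul, inner_smul_right,
    bas, mulL_mul, inner_one_mulL_pow_zC (B.mulL_denInv_mem_hardy hh) (Nat.sub_pos_of_lt hi),
    mul_zero, map_zero]

/-- The basis functions as elements of the model space. -/
def vec (i : Fin m) : model α := ⟨ofCont (B.bas i), B.bas_mem_model i.2⟩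

/-- Negative indices are excluded by `f ∈ H²`. For `k = m + i`, the function `conj D * z ^ k` is a
multiple of `α * (D * z ^ i)`, hence orthogonal to `f`. So `D f` is a polynomial of degree below
`m`. -/
theorem coef_mulL_den_eq_zero {f : L2Circle} (hf : f ∈ model α) {k : ℤ}
    (hk : ∀ i : Fin m, k ≠ i) : coef k (mulL B.den f) = 0 := by
  by_cases hneg : k < 0
  · exact (mem_hardy_iff _).mp
      ((mulL_prod_linC_mem_hardy_iff Finset.univ B.norm_a f).mpr hf.1) k hneg
  obtain ⟨l, rfl⟩ := Int.eq_ofNat_of_zero_le (not_lt.mp hneg)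
  have hl : m ≤ l := by
    by_contra h
    exact hk ⟨l, not_le.mp h⟩ rfl
  obtain ⟨i, rfl⟩ := Nat.exists_eq_add_of_le hl
  have hmem : ofCont (B.den * zC ^ i) ∈ hardy := by
    rw [← mulL_ofCont]
    exact (mulL_prod_linC_mem_hardy_iff Finset.univ B.norm_a _).mpr (ofCont_pow_zC_mem_hardy i)
  have heq : star B.den * zC ^ (m + i) = conj B.c • (B.bl * (B.den * zC ^ i)) := by
    rw [bl, smul_mul_assoc, smul_smul, B.conj_c_mul_c, one_smul]
    calc _ = star B.den * zC ^ (m + i) * (B.den * B.denInv) := by rw [den_mul_denInv, mul_one]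
      _ = _ := by ring
  have h0 : inner ℂ (mulL B.bl (ofCont (B.den * zC ^ i))) f = 0 :=
    (Submodule.mem_orthogonal _ _).mp hf.2 _ ((B.mem_mulHardy_iff _).mpr ⟨_, hmem, rfl⟩)
  rw [coef, inner_mulL, fourier_natCast, mulL_ofCont, heq, map_smul, inner_smul_left,
    ← mulL_ofCont, h0, mul_zero]

theorem exists_eq_sum_vec (f : model α) : ∃ x : Fin m → ℂ, f = ∑ i, x i • B.vec i := by
  refine ⟨fun i => coef i (mulL B.den f), ?_⟩
  have hF : mulL B.den f = ∑ i : Fin m, coef i (mulL B.den f) • ofCont (zC ^ (i : ℕ)) := by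
    apply ext_coef
    intro k
    conv_rhs => rw [coef, inner_sum]
    simp only [inner_smul_right]
    have hc : ∀ i : Fin m, inner ℂ (ofCont (fourier k)) (ofCont (zC ^ (i : ℕ)))
        = if k = i then (1 : ℂ) else 0 := by
      intro i
      rw [← fourier_natCast]
      exact coef_ofCont_fourier k i
    simp only [hc]
    by_cases hk : ∃ i : Fin m, k = i
    · obtain ⟨i, rfl⟩ := hk
      rw [Finset.sum_eq_single i]
      · simp
      · intro j _ hj
        rw [if_neg, mul_zero]
        intro h
        exact hj (Fin.ext (by exact_mod_cast h.symm))
      · simp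
    · rw [B.coef_mulL_den_eq_zero f.2 (fun i hi => hk ⟨i, hi⟩), Finset.sum_eq_zero]
      intro i _
      rw [if_neg (fun h => hk ⟨i, h⟩), mul_zero]
  apply Subtype.ext
  have h1 : (f : L2Circle) = mulL B.denInv (mulL B.den f) := by
    rw [← mulL_mul, mul_comm B.denInv, den_mul_denInv, mulL_one]
  conv_lhs => rw [h1, hF]
  rw [map_sum, Submodule.coe_sum]
  refine Finset.sum_congr rfl fun i _ => ?_
  rw [map_smul, mulL_ofCont, mul_comm B.denInv]
  rfl

theorem conj_inner_model (f g : model α) : conj (inner ℂ g f) = inner ℂ f g :=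
  inner_conj_symm (𝕜 := ℂ) f g

theorem inner_smul_model (f g : model α) (c : ℂ) : inner ℂ f (c • g) = c * inner ℂ f g :=
  inner_smul_right (𝕜 := ℂ) f g c

/-- An element of the model space orthogonal to all the basis functions vanishes. -/
theorem eq_zero_of_inner_vec {f : model α} (h : ∀ i, inner ℂ (B.vec i) f = 0) : f = 0 := by
  obtain ⟨x, hx⟩ := B.exists_eq_sum_vec f
  rw [← inner_self_eq_zero (𝕜 := ℂ)]
  nth_rewrite 1 [hx]
  rw [sum_inner]
  refine Finset.sum_eq_zero fun i _ => ?_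
  have h1 := inner_smul_left (𝕜 := ℂ) (B.vec i) f (x i)
  rw [h, mul_zero] at h1
  exact h1

end BlaschkeData

/-! ### The circle is infinite and its points are null sets. -/

instance nontrivial_circleParam : Nontrivial CircleParam := by
  by_contra h
  rw [not_nontrivial_iff_subsingleton] at h
  have h1 : (fourier 1 : C(CircleParam, ℂ)) = fourier 0 := by
    ext t
    rw [Subsingleton.elim t 0, fourier_eval_zero, fourier_eval_zero]
  have h2 := mean_fourier 1
  rw [h1, mean_fourier] at h2
  simp at h2

instance infinite_circleParam : Infinite CircleParam :=
  Set.infinite_univ_iff.mp (infinite_of_mem_nhds (0 : CircleParam) Filter.univ_mem)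

instance nullSingletonClass_haarAddCircle :
    NullSingletonClass (haarAddCircle : Measure CircleParam) := by
  -- Nondiscreteness at the neutral element is what makes Haar measure atomless.
  have : (nhdsWithin (0 : CircleParam) {0}ᶜ).NeBot := inferInstance
  infer_instance

/-! ### Truncated Toeplitz operators as Hankel matrices. -/

namespace BlaschkeData

variable {α β : ℂ → ℂ} {m n : ℕ} (B : BlaschkeData α m) (B' : BlaschkeData β n)

/-- The matrix of an operator between model spaces, with respect to the basis functions of `K_α`
and the basis functions of `K_β` in reversed order. -/
def entry (A : model α →L[ℂ] model β) (i : Fin m) (j : Fin n) : ℂ :=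
  inner ℂ (B'.vec j.rev) (A (B.vec i))

theorem ext_entry {A A' : model α →L[ℂ] model β}
    (h : ∀ i j, B.entry B' A i j = B.entry B' A' i j) : A = A' := by
  have hvec : ∀ i, A (B.vec i) = A' (B.vec i) := by
    intro i
    rw [← sub_eq_zero]
    refine B'.eq_zero_of_inner_vec fun j => ?_
    have h1 := h i j.rev
    rw [entry, entry, Fin.rev_rev] at h1
    rw [inner_sub_right, h1, sub_self]
  ext1 f
  obtain ⟨x, hx⟩ := B.exists_eq_sum_vec f
  rw [hx, map_sum, map_sum]
  refine Finset.sum_congr rfl fun i _ => ?_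
  rw [map_smul, map_smul, hvec]

theorem memLp_top_vec (i : Fin m) :
    MemLp ((B.vec i : L2Circle) : CircleParam → ℂ) ⊤ (haarAddCircle : Measure CircleParam) :=
  (ContinuousMap.memLp (p := ⊤) (haarAddCircle : Measure CircleParam) ℂ (B.bas i)).ae_eq
    (coeFn_ofCont (B.bas i)).symm

/-- The product `conj (bas' (n - 1)) * bas 0`. -/
def weight : C(CircleParam, ℂ) := zC * star (zC ^ n) * star B'.denInv * B.denInv

/-- The exponent is `i - (n - 1 - j) = (i + j) - (n - 1)`; reversing the second basis turns the
Toeplitz pattern into a Hankel one. -/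
theorem star_bas_rev_mul_bas (i : Fin m) (j : Fin n) :
    star (B'.bas j.rev) * B.bas i = zC ^ (i + j : ℕ) * B.weight B' := by
  have h1 := star_mul_zC_pow ((j : ℕ) + 1)
  have h2 : n = (j.rev : ℕ) + (j + 1) := by rw [Fin.val_rev]; omega
  have h3 : star (zC ^ n) = star (zC ^ (j + 1 : ℕ)) * star (zC ^ (j.rev : ℕ)) := by
    rw [← star_mul, ← pow_add, ← h2]
  rw [bas, bas, weight, h3, star_mul]
  calc _ = star (zC ^ (j.rev : ℕ)) * star B'.denInv * zC ^ (i : ℕ) * B.denInv * 1 := by ring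
    _ = _ := by rw [← h1]; ring

theorem exists_mul_weight : ∃ ψ, B.weight B' * ψ = 1 := by
  refine ⟨star zC * zC ^ n * star B'.den * B.den, ?_⟩
  calc _ = (zC * star zC) * (star (zC ^ n) * zC ^ n) * (star B'.den * star B'.denInv) *
        (B.den * B.denInv) := by rw [weight]; ring
    _ = 1 := by
      rw [zC_mul_star, star_mul_zC_pow, star_den_mul_star_denInv, den_mul_denInv]; ring

theorem exists_mem_asymTruncToeplitz (l : ℕ → ℂ) :
    ∃ A ∈ asymTruncToeplitz α β, ∀ i j, B.entry B' A i j = l (i + j) := by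
  obtain ⟨ψ, hψ⟩ := B.exists_mul_weight B'
  -- Dividing by the weight leaves `z ^ (i + j) * ∑ l k * z ^ (-k)`, whose mean picks out `l (i +
  -- j)`. The range `m + n` covers every index `i + j`.
  set φ : C(CircleParam, ℂ) :=
    ψ * ∑ k ∈ Finset.range (m + n), l k • (fourier (-k) : C(CircleParam, ℂ)) with hφ
  refine ⟨(model β).orthogonalProjectionOnto ∘L mulL φ ∘L (model α).subtypeL,
    ⟨ofCont φ, fun f _ => ⟨mulL φ f, ?_, rfl⟩⟩, fun i j => ?_⟩
  · filter_upwards [coeFn_mulL φ f, coeFn_ofCont φ] with t h₁ h₂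
    rw [h₁, h₂]
  · have h1 : B.entry B' ((model β).orthogonalProjectionOnto ∘L mulL φ ∘L (model α).subtypeL) i j
        = inner ℂ (ofCont (B'.bas j.rev)) (mulL φ (ofCont (B.bas i))) :=
      Submodule.inner_orthogonalProjectionOnto_eq_of_mem_left (B'.vec j.rev) _
    have h2 : star (B'.bas j.rev) * (φ * B.bas i) =
        ∑ k ∈ Finset.range (m + n), l k • (fourier ((i + j : ℕ) - k : ℤ) : C(CircleParam, ℂ)) := by
      calc _ = (star (B'.bas j.rev) * B.bas i) * φ := by ring
        _ = (B.weight B' * ψ) * (zC ^ (i + j : ℕ) * ∑ k ∈ Finset.range (m + n),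
              l k • (fourier (-k) : C(CircleParam, ℂ))) := by
            rw [star_bas_rev_mul_bas, hφ]; ring
        _ = _ := by
            rw [hψ, one_mul, Finset.mul_sum]
            refine Finset.sum_congr rfl fun k _ => ?_
            rw [mul_smul_comm, ← fourier_natCast, fourier_mul_fourier, sub_eq_add_neg]
    rw [h1, mulL_ofCont, inner_ofCont, h2, mean_sum, Finset.sum_eq_single (i + j : ℕ)]
    · rw [mean_smul, sub_self, mean_fourier, if_pos rfl, mul_one]
    · intro k _ hk
      rw [mean_smul, mean_fourier, if_neg (by omega), mul_zero]
    · intro h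
      exact absurd (Finset.mem_range.mpr (by omega)) h

theorem mem_asymTruncToeplitz_iff (A : model α →L[ℂ] model β) :
    A ∈ asymTruncToeplitz α β ↔ ∃ l : ℕ → ℂ, ∀ i j, B.entry B' A i j = l (i + j) := by
  constructor
  · rintro ⟨φ, hφ⟩
    refine ⟨fun k => inner ℂ (ofCont 1) (mulL (zC ^ k * B.weight B') φ), fun i j => ?_⟩
    obtain ⟨h, hh, hA⟩ := hφ (B.vec i) (B.memLp_top_vec i)
    have h1 : h = mulL (B.bas i) φ := by
      apply Lp.ext
      have hv : ((B.vec i : L2Circle) : CircleParam → ℂ) =ᵐ[haarAddCircle] B.bas i :=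
        coeFn_ofCont _
      filter_upwards [hh, coeFn_mulL (B.bas i) φ, hv] with t e₁ e₂ e₃
      rw [e₁, e₂, e₃, mul_comm]
    beta_reduce
    rw [entry, hA, h1, ← star_bas_rev_mul_bas, ← inner_ofCont_mulL]
    exact Submodule.inner_orthogonalProjectionOnto_eq_of_mem_left (B'.vec j.rev) _
  · rintro ⟨l, hl⟩
    obtain ⟨A', hA', hl'⟩ := B.exists_mem_asymTruncToeplitz B' l
    rwa [B.ext_entry B' (fun i j => (hl i j).trans (hl' i j).symm)]

end BlaschkeData

/-! ### Kernel functions and their pairings with the basis. -/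

namespace BlaschkeData

variable {α : ℂ → ℂ} {m : ℕ} (B : BlaschkeData α m)

/-- The numerator of the Blaschke product. -/
def numPoly : Polynomial ℂ := Polynomial.C B.c * ∏ j, (Polynomial.X - Polynomial.C (B.a j))

/-- The denominator of the Blaschke product. -/
def denPoly : Polynomial ℂ := ∏ j, (1 - Polynomial.C (conj (B.a j)) * Polynomial.X)

theorem natDegree_numPoly_le : B.numPoly.natDegree ≤ m := by
  refine (Polynomial.natDegree_C_mul_le _ _).trans ?_
  rw [Polynomial.natDegree_prod_of_monic _ _ fun j _ => Polynomial.monic_X_sub_C _]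
  simp

theorem natDegree_denPoly_le : B.denPoly.natDegree ≤ m := by
  refine (Polynomial.natDegree_prod_le _ _).trans ?_
  refine (Finset.sum_le_card_nsmul _ _ 1 fun j _ => ?_).trans (by simp)
  refine (Polynomial.natDegree_sub_le _ _).trans (max_le (by simp) ?_)
  exact (Polynomial.natDegree_C_mul_le _ _).trans (by simp)

theorem eval_denPoly (z : ℂ) : B.denPoly.eval z = ∏ j, (1 - conj (B.a j) * z) := by
  rw [denPoly, Polynomial.eval_prod]
  simp

theorem eval_numPoly (z : ℂ) : B.numPoly.eval z = B.c * ∏ j, (z - B.a j) := by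
  rw [numPoly, Polynomial.eval_mul, Polynomial.eval_prod]
  simp

theorem eval_denPoly_ne_zero {z : ℂ} (hz : ‖z‖ ≤ 1) : B.denPoly.eval z ≠ 0 := by
  rw [eval_denPoly]
  exact Finset.prod_ne_zero_iff.mpr fun j _ => one_sub_conj_mul_ne_zero (B.norm_a j) hz

theorem numPoly_ne_zero : B.numPoly ≠ 0 := by
  refine mul_ne_zero (by simpa using B.c_ne_zero) ?_
  exact (Polynomial.monic_prod_of_monic _ _ fun j _ => Polynomial.monic_X_sub_C _).ne_zero

theorem eval_numPoly_eq {z : ℂ} (hz : ‖z‖ ≤ 1) :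
    B.numPoly.eval z = α z * B.denPoly.eval z := by
  rw [B.eq z hz, Finset.prod_div_distrib, ← eval_denPoly, eval_numPoly, mul_assoc,
    div_mul_cancel₀ _ (B.eval_denPoly_ne_zero hz)]

theorem exists_poly_conjKernel (hm : 0 < m) {w : ℂ} (hw : ‖w‖ ≤ 1) :
    ∃ q : Polynomial ℂ, q ≠ 0 ∧ q.natDegree < m ∧
      B.numPoly - Polynomial.C (α w) * B.denPoly = (Polynomial.X - Polynomial.C w) * q := by
  have hroot : (B.numPoly - Polynomial.C (α w) * B.denPoly).IsRoot w := by
    rw [Polynomial.IsRoot.def, Polynomial.eval_sub, Polynomial.eval_mul, Polynomial.eval_C,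
      B.eval_numPoly_eq hw, sub_self]
  -- At a zero of `α` the numerator vanishes and the denominator does not, so equality would force
  -- `α w = 0` and then a zero numerator.
  have hne : B.numPoly - Polynomial.C (α w) * B.denPoly ≠ 0 := by
    intro h
    have h1 : B.numPoly.eval (B.a ⟨0, hm⟩) = 0 := by
      rw [eval_numPoly, Finset.prod_eq_zero (Finset.mem_univ ⟨0, hm⟩) (sub_self _), mul_zero]
    have h2 := congrArg (Polynomial.eval (B.a ⟨0, hm⟩)) h
    rw [Polynomial.eval_sub, Polynomial.eval_mul, Polynomial.eval_C, h1, zero_sub,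
      Polynomial.eval_zero, neg_eq_zero, mul_eq_zero,
      or_iff_left (B.eval_denPoly_ne_zero (B.norm_a _).le)] at h2
    rw [h2, Polynomial.C_0, zero_mul, sub_zero] at h
    exact B.numPoly_ne_zero h
  have hdeg : (B.numPoly - Polynomial.C (α w) * B.denPoly).natDegree ≤ m :=
    (Polynomial.natDegree_sub_le _ _).trans (max_le B.natDegree_numPoly_le
      ((Polynomial.natDegree_C_mul_le _ _).trans B.natDegree_denPoly_le))
  obtain ⟨q, hq⟩ := Polynomial.dvd_iff_isRoot.mpr hroot
  have hq0 : q ≠ 0 := by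
    rintro rfl
    exact hne (by rw [hq, mul_zero])
  refine ⟨q, hq0, ?_, hq⟩
  rw [hq, Polynomial.natDegree_mul (Polynomial.X_sub_C_ne_zero w) hq0,
    Polynomial.natDegree_X_sub_C] at hdeg
  omega

/-- Cancelling the factor `z - w` between polynomials gives a continuous function even when `|w| =
1`. The defining relation is kept in product form, so no exceptional point appears. -/
theorem exists_cont_conjKernel (hm : 0 < m) {w : ℂ} (hw : ‖w‖ ≤ 1) :
    ∃ (κ : C(CircleParam, ℂ)) (x : Fin m → ℂ), κ ≠ 0 ∧ κ = ∑ i : Fin m, x i • B.bas i ∧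
      (zC - w • 1) * κ = B.bl - α w • 1 := by
  obtain ⟨q, hq0, hdeg, hq⟩ := B.exists_poly_conjKernel hm hw
  have happ : ∀ t, (∑ i : Fin m, q.coeff i • B.bas i) t
      = q.eval (circlePt t) / B.denPoly.eval (circlePt t) := by
    intro t
    rw [ContinuousMap.sum_apply, Polynomial.eval_eq_sum_range' hdeg, Finset.sum_div,
      ← Fin.sum_univ_eq_sum_range
        (fun i => q.coeff i * circlePt t ^ i / B.denPoly.eval (circlePt t))]
    refine Finset.sum_congr rfl fun i _ => ?_
    rw [ContinuousMap.smul_apply, bas, ContinuousMap.mul_apply, ContinuousMap.pow_apply,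
      denInv_apply, den_apply, zC_apply, eval_denPoly, smul_eq_mul, div_eq_mul_inv, mul_assoc]
  refine ⟨∑ i : Fin m, q.coeff i • B.bas i, fun i => q.coeff i, ?_, rfl, ?_⟩
  · intro h
    apply hq0
    refine Polynomial.eq_zero_of_infinite_isRoot q ?_
    have hinf : (Set.range circlePt).Infinite := by
      refine Set.infinite_range_of_injective ?_
      exact Subtype.val_injective.comp (injective_toCircle (by positivity))
    refine hinf.mono ?_
    rintro _ ⟨t, rfl⟩
    have h1 := happ t
    rw [h, ContinuousMap.zero_apply, eq_comm, div_eq_zero_iff,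
      or_iff_left (B.eval_denPoly_ne_zero (norm_circlePt t).le)] at h1
    exact h1
  · ext t
    have h1 := congrArg (Polynomial.eval (circlePt t)) hq
    have hd := B.eval_denPoly_ne_zero (norm_circlePt t).le
    rw [Polynomial.eval_sub, Polynomial.eval_mul, Polynomial.eval_mul, Polynomial.eval_C,
      Polynomial.eval_sub, Polynomial.eval_X, Polynomial.eval_C,
      B.eval_numPoly_eq (norm_circlePt t).le, ← sub_mul] at h1
    rw [ContinuousMap.mul_apply, happ, ContinuousMap.sub_apply, ContinuousMap.sub_apply, zC_apply,
      bl_apply, ContinuousMap.smul_apply, ContinuousMap.smul_apply, ContinuousMap.one_apply,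
      smul_eq_mul, smul_eq_mul, mul_one, mul_one, ← mul_div_assoc, ← h1, mul_div_cancel_right₀ _ hd]

/-- The conjugation `f ↦ α conj (z f)` on continuous functions. -/
def conjC (κ : C(CircleParam, ℂ)) : C(CircleParam, ℂ) := B.bl * star (zC * κ)

theorem conjC_bas (i : Fin m) : B.conjC (B.bas i) = B.c • B.bas i.rev := by
  have h := B.star_bas_mul_bl (i := i + 1) i.2
  have h2 : zC * B.bas i = B.bas (i + 1) := by rw [bas, bas, pow_succ]; ring
  rw [conjC, h2, mul_comm B.bl, h, Fin.val_rev]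

theorem star_conjC (κ : C(CircleParam, ℂ)) : star (B.conjC κ) = star B.bl * zC * κ := by
  rw [conjC, star_mul, star_star]; ring

theorem conjC_sum (x : Fin m → ℂ) :
    B.conjC (∑ i : Fin m, x i • B.bas i) = ∑ i : Fin m, (conj (x i) * B.c) • B.bas i.rev := by
  have h : B.conjC (∑ i : Fin m, x i • B.bas i)
      = ∑ i : Fin m, conj (x i) • B.conjC (B.bas i) := by
    simp only [conjC, Finset.mul_sum, star_sum, mul_smul_comm, star_smul]
    rfl
  rw [h]
  exact Finset.sum_congr rfl fun i _ => by rw [conjC_bas, smul_smul]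

theorem conjC_ne_zero {κ : C(CircleParam, ℂ)} (h : κ ≠ 0) : B.conjC κ ≠ 0 := by
  intro h0
  apply h
  have h1 := B.star_conjC κ
  rw [h0, star_zero] at h1
  calc κ = (star B.bl * B.bl) * (zC * star zC) * κ := by
        rw [star_bl_mul_bl, zC_mul_star]; ring
    _ = B.bl * star zC * (star B.bl * zC * κ) := by ring
    _ = 0 := by rw [← h1, mul_zero]

/-- The conjugation carries the conjugate kernel to the kernel: conjugate the relation and multiply
by `α`, using `|α| = 1`. -/
theorem mul_conjC {κ : C(CircleParam, ℂ)} {w : ℂ} (h : (zC - w • 1) * κ = B.bl - α w • 1) :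
    linC w * B.conjC κ = 1 - conj (α w) • B.bl := by
  have h1 := congrArg star h
  simp only [star_mul, star_sub, star_smul, star_one, RCLike.star_def] at h1
  have h2 : linC w = zC * (star zC - conj w • 1) := by
    rw [linC, mul_sub, zC_mul_star, mul_smul_comm, mul_one]
  have h3 := B.star_bl_mul_bl
  calc linC w * B.conjC κ
      = (zC * star zC) * B.bl * (star κ * (star zC - conj w • 1)) := by
        rw [h2, conjC, star_mul]; ring
    _ = 1 - conj (α w) • B.bl := by
        rw [zC_mul_star, h1, one_mul, mul_sub, mul_comm B.bl, h3, mul_smul_comm, mul_one]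

/-- This replaces the reproducing property. Since `(z - w) * conj k = z * (1 - α w * conj α)`, the
difference of the two sides is the mean of `bas (i + 1)` minus `α w` times that of `conj α * bas (i
+ 1)`; both means vanish because `0 < i + 1 < m`. -/
theorem mean_star_mul_bas_succ {k : C(CircleParam, ℂ)} {w : ℂ}
    (h : linC w * k = 1 - conj (α w) • B.bl) {i : ℕ} (hi : i + 1 < m) :
    mean (star k * B.bas (i + 1)) = w * mean (star k * B.bas i) := by
  have h1 := congrArg star h
  have h2 : zC * star (linC w) = zC - w • 1 := by
    rw [linC, star_sub, star_one, star_smul, RCLike.star_def, Complex.conj_conj, mul_sub,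
      mul_smul_comm, zC_mul_star, mul_one]
  have h3 : B.bas (i + 1) = zC * B.bas i := by rw [bas, bas, pow_succ]; ring
  have h4 : star B.bl * B.bas (i + 1) = star (B.c • B.bas (m - (i + 1))) := by
    rw [← B.star_bas_mul_bl hi.le, star_mul, star_star]
  have h5 : star k * B.bas (i + 1) - w • (star k * B.bas i)
      = B.bas (i + 1) - α w • star (B.c • B.bas (m - (i + 1))) := by
    calc _ = star k * (zC - w • 1) * B.bas i := by
          rw [h3, mul_sub, sub_mul, mul_smul_comm, smul_mul_assoc, mul_one]; ring
      _ = star (linC w * k) * B.bas (i + 1) := by rw [← h2, h3, star_mul]; ring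
      _ = _ := by
        rw [h1, star_sub, star_one, star_smul, RCLike.star_def, Complex.conj_conj, sub_mul,
          one_mul, smul_mul_assoc, h4]
  have h6 := congrArg mean h5
  rw [mean_sub, mean_smul, mean_sub, mean_smul, mean_star, mean_smul, B.mean_bas (Nat.succ_pos i),
    B.mean_bas (by omega)] at h6
  simp only [mul_zero, map_zero, sub_zero] at h6
  exact sub_eq_zero.mp h6

theorem mean_star_mul_bas {k : C(CircleParam, ℂ)} {w : ℂ}
    (h : linC w * k = 1 - conj (α w) • B.bl) {i : ℕ} (hi : i < m) :
    mean (star k * B.bas i) = mean (star k * B.bas 0) * w ^ i := by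
  induction i with
  | zero => simp
  | succ i ih =>
    rw [B.mean_star_mul_bas_succ h hi, ih (by omega), pow_succ]; ring

/-- The conjugation is antiunitary and reverses the basis, so pairings with the conjugate kernel
reduce to pairings with the kernel. -/
theorem star_bas_rev_mul (κ : C(CircleParam, ℂ)) (j : Fin m) :
    star (B.bas j.rev) * κ = B.c • (star (B.conjC κ) * B.bas j) := by
  have h := B.conjC_bas j
  have h1 : star (B.bas j.rev) = B.c • star (B.conjC (B.bas j)) := by
    rw [h, star_smul, smul_smul, RCLike.star_def, mul_comm B.c, B.conj_c_mul_c, one_smul]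
  rw [h1, smul_mul_assoc, star_conjC, star_conjC]
  congr 1
  ring

theorem ae_circlePt_ne (w : ℂ) :
    ∀ᵐ t ∂(haarAddCircle : Measure CircleParam), circlePt t ≠ w := by
  have hs : ({t | circlePt t = w} : Set CircleParam).Subsingleton := by
    intro t ht s hs
    exact injective_toCircle (by positivity) (Subtype.ext (Eq.trans ht (Eq.symm hs)))
  rw [ae_iff]
  simpa using hs.measure_zero (haarAddCircle : Measure CircleParam)

/-- The kernel functions exist, and their coefficients are geometric progressions. -/
theorem exists_kernels (hm : 0 < m) {w : ℂ} (hw : ‖w‖ ≤ 1) :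
    ∃ (f g : model α) (u v : ℂ), IsKernel α w f ∧ IsConjKernel α w g ∧ u ≠ 0 ∧ v ≠ 0 ∧
      (∀ i : Fin m, inner ℂ f (B.vec i) = u * w ^ (i : ℕ)) ∧
      (∀ i : Fin m, inner ℂ (B.vec i.rev) g = v * w ^ (i : ℕ)) := by
  obtain ⟨κ, x, hκ0, hκ, hmul⟩ := B.exists_cont_conjKernel hm hw
  have hk := B.mul_conjC hmul
  have hsum : B.conjC κ = ∑ i : Fin m, (conj (x i) * B.c) • B.bas i.rev := by
    rw [hκ, conjC_sum]
  have hgmem : ofCont κ ∈ model α := by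
    rw [hκ, map_sum]
    refine Submodule.sum_mem _ fun i _ => ?_
    rw [map_smul]
    exact Submodule.smul_mem _ _ (B.bas_mem_model i.2)
  have hfmem : ofCont (B.conjC κ) ∈ model α := by
    rw [hsum, map_sum]
    refine Submodule.sum_mem _ fun i _ => ?_
    rw [map_smul]
    exact Submodule.smul_mem _ _ (B.bas_mem_model i.rev.2)
  have hu : ∀ i : Fin m, inner ℂ (⟨ofCont (B.conjC κ), hfmem⟩ : model α) (B.vec i)
      = mean (star (B.conjC κ) * B.bas 0) * w ^ (i : ℕ) := by
    intro i
    rw [← B.mean_star_mul_bas hk i.2, ← inner_ofCont]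
    rfl
  have hu0 : mean (star (B.conjC κ) * B.bas 0) ≠ 0 := by
    intro h0
    have h1 : (⟨ofCont (B.conjC κ), hfmem⟩ : model α) = 0 := by
      refine B.eq_zero_of_inner_vec fun i => ?_
      rw [← conj_inner_model, hu, h0, zero_mul, map_zero]
    have h2 : ofCont (B.conjC κ) = ofCont 0 := by
      rw [map_zero]; exact congrArg Subtype.val h1
    exact B.conjC_ne_zero hκ0 (ofCont_injective h2)
  refine ⟨⟨_, hfmem⟩, ⟨_, hgmem⟩, _, B.c * mean (star (B.conjC κ) * B.bas 0), ?_, ?_, hu0,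
    mul_ne_zero B.c_ne_zero hu0, hu, ?_⟩
  · change ∀ᵐ t ∂_, (ofCont (B.conjC κ) : CircleParam → ℂ) t = _
    filter_upwards [coeFn_ofCont (B.conjC κ), ae_circlePt_ne w] with t h₁ h₂
    have h3 := DFunLike.congr_fun hk t
    rw [ContinuousMap.mul_apply, linC_apply, ContinuousMap.sub_apply, ContinuousMap.smul_apply,
      bl_apply, smul_eq_mul, ContinuousMap.one_apply] at h3
    rw [h₁, eq_div_iff, mul_comm, h3]
    intro h0
    apply h₂
    have h4 := congrArg conj h0
    rw [map_sub, map_mul, map_one, map_zero, Complex.conj_conj] at h4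
    linear_combination circlePt t * h4 + w * circlePt_mul_conj t
  · change ∀ᵐ t ∂_, (ofCont κ : CircleParam → ℂ) t = _
    filter_upwards [coeFn_ofCont κ, ae_circlePt_ne w] with t h₁ h₂
    have h3 := DFunLike.congr_fun hmul t
    rw [ContinuousMap.mul_apply, ContinuousMap.sub_apply, ContinuousMap.sub_apply, zC_apply,
      ContinuousMap.smul_apply, ContinuousMap.smul_apply, bl_apply, smul_eq_mul, smul_eq_mul,
      ContinuousMap.one_apply, mul_one, mul_one] at h3
    rw [h₁, eq_div_iff (sub_ne_zero.mpr h₂), mul_comm, h3]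
  · intro i
    rw [mul_assoc, ← B.mean_star_mul_bas hk i.2, ← mean_smul, ← star_bas_rev_mul, ← inner_ofCont]
    rfl

end BlaschkeData

/-! ### Point evaluations and rank-one Hankel matrices. -/

/-- The values on the monomials `z ^ k`, `k ≤ N`, of a nonzero multiple of the evaluation at
a finite point or at infinity of polynomials of degree at most `N`. -/
def IsPointEval (N : ℕ) (l : ℕ → ℂ) : Prop :=
  (∃ C : ℂ, C ≠ 0 ∧ ∃ w : ℂ, ∀ k ≤ N, l k = C * w ^ k) ∨
    ∃ C : ℂ, C ≠ 0 ∧ ∀ k ≤ N, l k = if k = N then C else 0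

/-- By inversion, the point of an evaluation may be taken in the closed disk. -/
theorem IsPointEval.exists_norm_le {N : ℕ} {l : ℕ → ℂ} (h : IsPointEval N l) :
    ∃ w : ℂ, ‖w‖ ≤ 1 ∧ ∃ C : ℂ, C ≠ 0 ∧
      ((∀ k ≤ N, l k = C * w ^ k) ∨ ∀ k ≤ N, l k = C * w ^ (N - k)) := by
  rcases h with ⟨C, hC, w, h⟩ | ⟨C, hC, h⟩
  · by_cases hw : ‖w‖ ≤ 1
    · exact ⟨w, hw, C, hC, Or.inl h⟩
    · have hw0 : w ≠ 0 := by
        rintro rfl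
        simp at hw
      -- Here `w ^ k = w ^ N * w⁻¹ ^ (N - k)`; below, infinity is reflected to `0`, with `0 ^ 0 = 1`
      -- at `k = N`.
      refine ⟨w⁻¹, ?_, C * w ^ N, mul_ne_zero hC (pow_ne_zero _ hw0), Or.inr fun k hk => ?_⟩
      · rw [norm_inv]
        exact inv_le_one_of_one_le₀ (not_le.mp hw).le
      · rw [h k hk, mul_assoc]
        congr 1
        rw [inv_pow, eq_mul_inv_iff_mul_eq₀ (pow_ne_zero _ hw0), ← pow_add, Nat.add_sub_cancel' hk]
  · refine ⟨0, by simp, C, hC, Or.inr fun k hk => ?_⟩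
    rw [h k hk]
    by_cases hkN : k = N
    · simp [hkN]
    · rw [if_neg hkN, zero_pow (by omega), mul_zero]

/-- A nonzero functional on polynomials of degree at most one is determined up to scale by the ratio
`l 1 / l 0`, a point of the sphere. For `N = 0` any ratio serves. -/
theorem isPointEval_of_le_one {N : ℕ} (hN : N ≤ 1) {l : ℕ → ℂ} (h : ∃ k ≤ N, l k ≠ 0) :
    IsPointEval N l := by
  obtain ⟨k, hk, hlk⟩ := h
  by_cases h0 : l 0 = 0
  · have hk1 : k = N := by
      rcases Nat.eq_zero_or_pos k with rfl | hpos
      · exact absurd h0 hlk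
      · omega
    subst hk1
    refine Or.inr ⟨l k, hlk, fun i hi => ?_⟩
    by_cases hik : i = k
    · rw [if_pos hik, hik]
    · have : i = 0 := by omega
      rw [if_neg hik, this, h0]
  · refine Or.inl ⟨l 0, h0, l 1 / l 0, fun i hi => ?_⟩
    obtain rfl | rfl : i = 0 ∨ i = 1 := by omega
    · simp
    · rw [pow_one, mul_div_cancel₀ _ h0]

section Hankel

variable {m n : ℕ} {x y : ℕ → ℂ}

/-- A rank-one Hankel matrix with vanishing first entry has only its last entry nonzero. -/
theorem hankel_eq_zero_of_left (hn : 1 < n)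
    (h : ∀ i j, i + 1 < m → j + 1 < n → x i * y (j + 1) = x (i + 1) * y j)
    (hx : ∃ i < m, x i ≠ 0) (hy : ∃ j < n, y j ≠ 0) (h0 : x 0 = 0) :
    (∀ i, i + 1 < m → x i = 0) ∧ ∀ j, j + 1 < n → y j = 0 := by
  have hy0 : ∀ j, j + 1 < n → y j = 0 := by
    intro j hj
    -- If `y j ≠ 0`, the relation `x (i + 1) * y j = x i * y (j + 1)` propagates `x 0 = 0` to every
    -- `x i`.
    by_contra hne
    obtain ⟨i, hi, hxi⟩ := hx
    apply hxi
    clear hxi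
    induction i with
    | zero => exact h0
    | succ i ih =>
      have h1 := h i j hi hj
      rw [ih (by omega), zero_mul, eq_comm, mul_eq_zero] at h1
      exact h1.resolve_right hne
  refine ⟨fun i hi => ?_, hy0⟩
  obtain ⟨j, hj, hyj⟩ := hy
  have hjn : j + 1 = n := by
    by_contra hne
    exact hyj (hy0 j (by omega))
  -- Only the last `y` survives; as `1 < n` there is a column before it, and its zero kills `x i`
  -- for `i + 1 < m`.
  obtain ⟨k, rfl⟩ : ∃ k, j = k + 1 := ⟨j - 1, by omega⟩
  have h1 := h i k hi (by omega)
  rw [hy0 k (by omega), mul_zero, mul_eq_zero] at h1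
  exact h1.resolve_right hyj

theorem hankel_eq_zero (hm : 1 < m) (hn : 1 < n)
    (h : ∀ i j, i + 1 < m → j + 1 < n → x i * y (j + 1) = x (i + 1) * y j)
    (hx : ∃ i < m, x i ≠ 0) (hy : ∃ j < n, y j ≠ 0) (h0 : x 0 * y 0 = 0) :
    (∀ i, i + 1 < m → x i = 0) ∧ ∀ j, j + 1 < n → y j = 0 := by
  rcases mul_eq_zero.mp h0 with h0 | h0
  · exact hankel_eq_zero_of_left hn h hx hy h0
  · refine (hankel_eq_zero_of_left hm (fun j i hj hi => ?_) hy hx h0).symm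
    rw [mul_comm, mul_comm (y (j + 1)), h i j hi hj]

/-- A Hankel matrix of rank one with at least two rows and columns comes from a point
evaluation. -/
theorem isPointEval_of_hankel (hm : 1 < m) (hn : 1 < n) {l : ℕ → ℂ}
    (h : ∀ i j, i < m → j < n → l (i + j) = x i * y j)
    (hne : ∃ i < m, ∃ j < n, x i * y j ≠ 0) : IsPointEval (m + n - 2) l := by
  have hrel : ∀ i j, i + 1 < m → j + 1 < n → x i * y (j + 1) = x (i + 1) * y j := by
    intro i j hi hj
    rw [← h i (j + 1) (by omega) hj, ← h (i + 1) j hi (by omega)]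
    congr 1
    omega
  have hsplit : ∀ k ≤ m + n - 2, ∃ i j, i < m ∧ j < n ∧ k = i + j := by
    intro k hk
    by_cases hkm : k < m
    · exact ⟨k, 0, hkm, by omega, rfl⟩
    · exact ⟨m - 1, k - (m - 1), by omega, by omega, by omega⟩
  obtain ⟨i₀, hi₀, j₀, hj₀, hij⟩ := hne
  have hx : ∃ i < m, x i ≠ 0 := ⟨i₀, hi₀, left_ne_zero_of_mul hij⟩
  have hy : ∃ j < n, y j ≠ 0 := ⟨j₀, hj₀, right_ne_zero_of_mul hij⟩
  by_cases h0 : x 0 * y 0 = 0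
  · obtain ⟨hx0, hy0⟩ := hankel_eq_zero hm hn hrel hx hy h0
    have hi : i₀ = m - 1 := by
      by_contra hne
      exact left_ne_zero_of_mul hij (hx0 _ (by omega))
    have hj : j₀ = n - 1 := by
      by_contra hne
      exact right_ne_zero_of_mul hij (hy0 _ (by omega))
    refine Or.inr ⟨x i₀ * y j₀, hij, fun k hk => ?_⟩
    obtain ⟨i, j, hi', hj', rfl⟩ := hsplit k hk
    rw [h i j hi' hj']
    split_ifs with hN
    · rw [show i = i₀ by omega, show j = j₀ by omega]
    · by_cases him : i + 1 < m
      · rw [hx0 i him, zero_mul]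
      · rw [hy0 j (by omega), mul_zero]
  · have hx0 := left_ne_zero_of_mul h0
    have hy0 := right_ne_zero_of_mul h0
    have hw : x 1 / x 0 = y 1 / y 0 := by
      rw [div_eq_div_iff hx0 hy0, ← hrel 0 0 (by omega) (by omega), mul_comm]
    have hxg : ∀ i < m, x i = x 0 * (x 1 / x 0) ^ i := by
      intro i
      induction i with
      | zero => simp
      | succ i ih =>
        intro hi
        have h1 := hrel i 0 hi (by omega)
        rw [pow_succ, ← mul_assoc, ← ih (by omega), hw, ← mul_div_assoc, h1,
          mul_div_cancel_right₀ _ hy0]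
    have hyg : ∀ j < n, y j = y 0 * (x 1 / x 0) ^ j := by
      intro j
      induction j with
      | zero => simp
      | succ j ih =>
        intro hj
        have h1 := hrel 0 j (by omega) hj
        rw [pow_succ, ← mul_assoc, ← ih (by omega), ← mul_div_assoc, mul_comm (y j), ← h1,
          mul_div_cancel_left₀ _ hx0]
    refine Or.inl ⟨x 0 * y 0, h0, x 1 / x 0, fun k hk => ?_⟩
    obtain ⟨i, j, hi, hj, rfl⟩ := hsplit k hk
    rw [h i j hi hj, hxg i hi, hyg j hj, pow_add]
    ring

end Hankel

/-! ### Kernel tensors and rank one in terms of matrices. -/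

theorem eq_of_isKernel {α : ℂ → ℂ} {w : ℂ} {f g : model α} (hf : IsKernel α w f)
    (hg : IsKernel α w g) : f = g := by
  apply Subtype.ext
  apply Lp.ext
  filter_upwards [hf, hg] with t h₁ h₂
  rw [h₁, h₂]

theorem eq_of_isConjKernel {α : ℂ → ℂ} {w : ℂ} {f g : model α} (hf : IsConjKernel α w f)
    (hg : IsConjKernel α w g) : f = g := by
  apply Subtype.ext
  apply Lp.ext
  filter_upwards [hf, hg] with t h₁ h₂
  rw [h₁, h₂]

namespace BlaschkeData

variable {α β : ℂ → ℂ} {m n : ℕ} (B : BlaschkeData α m) (B' : BlaschkeData β n)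

theorem entry_smul_rankOne (c : ℂ) (g : model β) (f : model α) (i : Fin m) (j : Fin n) :
    B.entry B' (c • InnerProductSpace.rankOne ℂ g f) i j
      = c * (inner ℂ f (B.vec i) * inner ℂ (B'.vec j.rev) g) := by
  have h : (c • InnerProductSpace.rankOne ℂ g f) (B.vec i)
      = (c * inner ℂ f (B.vec i)) • g := by
    rw [smul_apply, InnerProductSpace.rankOne_apply, smul_smul]
  rw [entry, h, ← mul_assoc, inner_smul_model]

/-- The kernel tensors are the operators whose matrix comes from a point of the closed disk,
or from the reflection of such a point. -/
theorem mem_kernelTensors_iff (hm : 0 < m) (hn : 0 < n) (A : model α →L[ℂ] model β) :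
    A ∈ kernelTensors α β ↔ ∃ w : ℂ, ‖w‖ ≤ 1 ∧ ∃ C : ℂ, C ≠ 0 ∧
      ((∀ i j, B.entry B' A i j = C * w ^ (i + j : ℕ)) ∨
        ∀ i j, B.entry B' A i j = C * w ^ (m + n - 2 - (i + j) : ℕ)) := by
  have hrev : ∀ (i : Fin m) (j : Fin n), m + n - 2 - (i + j : ℕ) = (i.rev : ℕ) + j.rev := by
    intro i j
    rw [Fin.val_rev, Fin.val_rev]
    omega
  simp only [hrev]
  constructor
  · rintro ⟨w, hw, c, hc, f, g, hfg, rfl⟩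
    obtain ⟨f₁, g₁, u₁, v₁, hf₁, hg₁, hu₁, hv₁, hfu₁, hgv₁⟩ := B.exists_kernels hm hw
    obtain ⟨f₂, g₂, u₂, v₂, hf₂, hg₂, hu₂, hv₂, hfu₂, hgv₂⟩ := B'.exists_kernels hn hw
    rcases hfg with ⟨hg, hf⟩ | ⟨hg, hf⟩
    · refine ⟨w, hw, c * (u₁ * v₂), mul_ne_zero hc (mul_ne_zero hu₁ hv₂), Or.inl fun i j => ?_⟩
      rw [entry_smul_rankOne, eq_of_isKernel hf hf₁, eq_of_isConjKernel hg hg₂, hfu₁, hgv₂]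
      ring
    -- Both factors now sit on the opposite side of the inner product from `exists_kernels`, so the
    -- point is conjugated and the indices are reversed.
    · refine ⟨conj w, by rwa [RCLike.norm_conj], c * conj (v₁ * u₂), mul_ne_zero hc
        (by rw [Ne, map_eq_zero]; exact mul_ne_zero hv₁ hu₂), Or.inr fun i j => ?_⟩
      have h1 := hgv₁ i.rev
      rw [Fin.rev_rev] at h1
      rw [entry_smul_rankOne, eq_of_isConjKernel hf hg₁, eq_of_isKernel hg hf₂,
        ← conj_inner_model, h1, ← conj_inner_model, hfu₂]
      simp only [map_mul, map_pow]
      ring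
  · rintro ⟨w, hw, C, hC, h | h⟩
    · obtain ⟨f₁, g₁, u₁, v₁, hf₁, hg₁, hu₁, hv₁, hfu₁, hgv₁⟩ := B.exists_kernels hm hw
      obtain ⟨f₂, g₂, u₂, v₂, hf₂, hg₂, hu₂, hv₂, hfu₂, hgv₂⟩ := B'.exists_kernels hn hw
      refine ⟨w, hw, C / (u₁ * v₂), div_ne_zero hC (mul_ne_zero hu₁ hv₂), f₁, g₂,
        Or.inl ⟨hg₂, hf₁⟩, B.ext_entry B' fun i j => ?_⟩
      rw [entry_smul_rankOne, hfu₁, hgv₂, h, pow_add]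
      field_simp
    · have hw' : ‖conj w‖ ≤ 1 := by rwa [RCLike.norm_conj]
      obtain ⟨f₁, g₁, u₁, v₁, hf₁, hg₁, hu₁, hv₁, hfu₁, hgv₁⟩ := B.exists_kernels hm hw'
      obtain ⟨f₂, g₂, u₂, v₂, hf₂, hg₂, hu₂, hv₂, hfu₂, hgv₂⟩ := B'.exists_kernels hn hw'
      have hv₁' : conj v₁ ≠ 0 := by rwa [Ne, map_eq_zero]
      have hu₂' : conj u₂ ≠ 0 := by rwa [Ne, map_eq_zero]
      refine ⟨conj w, hw', C / (conj v₁ * conj u₂), div_ne_zero hC (mul_ne_zero hv₁' hu₂'), g₁, f₂,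
        Or.inr ⟨hf₂, hg₁⟩, B.ext_entry B' fun i j => ?_⟩
      have h1 := hgv₁ i.rev
      rw [Fin.rev_rev] at h1
      rw [entry_smul_rankOne, ← conj_inner_model, h1, ← conj_inner_model, hfu₂, h, pow_add]
      simp only [map_mul, map_pow, Complex.conj_conj]
      field_simp

theorem finrank_range_eq_one_iff (A : model α →L[ℂ] model β) :
    Module.finrank ℂ (LinearMap.range A.toLinearMap) = 1 ↔
      (∃ x y : ℕ → ℂ, ∀ i j, B.entry B' A i j = x i * y j) ∧ ∃ i j, B.entry B' A i j ≠ 0 := by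
  constructor
  · intro h
    obtain ⟨⟨g, hg⟩, hg0, hspan⟩ := finrank_eq_one_iff'.mp h
    have hA : ∀ f, ∃ c : ℂ, A f = c • g := by
      intro f
      obtain ⟨c, hc⟩ := hspan ⟨A f, ⟨f, rfl⟩⟩
      exact ⟨c, (congrArg Subtype.val hc).symm⟩
    choose c hc using hA
    refine ⟨⟨fun i => if h : i < m then c (B.vec ⟨i, h⟩) else 0,
      fun j => if h : j < n then inner ℂ (B'.vec (Fin.rev ⟨j, h⟩)) g else 0, fun i j => ?_⟩, ?_⟩
    · beta_reduce
      rw [dif_pos i.2, dif_pos j.2, entry, hc, inner_smul_model]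
    · by_contra hall
      push Not at hall
      have hA0 : A = 0 := by
        refine B.ext_entry B' fun i j => ?_
        rw [hall]
        exact (inner_zero_right (𝕜 := ℂ) _).symm
      obtain ⟨f, hf⟩ := hg
      apply hg0
      apply Subtype.ext
      rw [hA0] at hf
      exact hf.symm
  · rintro ⟨⟨x, y, hxy⟩, i₀, j₀, hne⟩
    have hx0 : x i₀ ≠ 0 := by
      rw [hxy] at hne
      exact left_ne_zero_of_mul hne
    have hg0 : A (B.vec i₀) ≠ 0 := by
      intro h0
      apply hne
      rw [entry, h0]
      exact inner_zero_right (𝕜 := ℂ) _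
    have hvec : ∀ i, A (B.vec i) = (x i / x i₀) • A (B.vec i₀) := by
      intro i
      rw [← sub_eq_zero]
      refine B'.eq_zero_of_inner_vec fun j => ?_
      have h1 := hxy i j.rev
      have h2 := hxy i₀ j.rev
      rw [entry, Fin.rev_rev] at h1 h2
      rw [inner_sub_right, h1, inner_smul_model, h2, ← mul_assoc, div_mul_cancel₀ _ hx0, sub_self]
    refine finrank_eq_one_iff'.mpr ⟨⟨A (B.vec i₀), ⟨_, rfl⟩⟩, ?_, ?_⟩
    · intro h
      exact hg0 (congrArg Subtype.val h)
    · rintro ⟨_, f, rfl⟩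
      obtain ⟨c, hc⟩ := B.exists_eq_sum_vec f
      refine ⟨∑ i, c i * (x i / x i₀), Subtype.ext ?_⟩
      change (∑ i, c i * (x i / x i₀)) • A (B.vec i₀) = A f
      rw [hc, map_sum, Finset.sum_smul]
      refine Finset.sum_congr rfl fun i _ => ?_
      rw [map_smul, hvec i, smul_smul]

/-! ### The two inclusions and the exceptional sizes. -/

theorem kernelTensors_subset (B : BlaschkeData α m) (B' : BlaschkeData β n)
    (hm : 0 < m) (hn : 0 < n) :
    kernelTensors α β ⊆ rankOneToeplitz α β := by
  intro A hA
  -- Since `w = 0` is allowed, the nonzero entry is taken where the exponent is `0`: the first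
  -- entry, or the last in the reflected case.
  obtain ⟨w, hw, C, hC, h | h⟩ := (B.mem_kernelTensors_iff B' hm hn A).mp hA
  · refine ⟨(B.mem_asymTruncToeplitz_iff B' A).mpr ⟨fun k => C * w ^ k, h⟩,
      (B.finrank_range_eq_one_iff B' A).mpr ⟨⟨fun i => C * w ^ i, fun j => w ^ j, fun i j => ?_⟩,
        ⟨0, hm⟩, ⟨0, hn⟩, ?_⟩⟩
    · rw [h, pow_add, mul_assoc]
    · rw [h]
      simpa using hC
  · refine ⟨(B.mem_asymTruncToeplitz_iff B' A).mpr ⟨fun k => C * w ^ (m + n - 2 - k), h⟩,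
      (B.finrank_range_eq_one_iff B' A).mpr ⟨⟨fun i => C * w ^ (m - 1 - i),
        fun j => w ^ (n - 1 - j), fun i j => ?_⟩, ⟨m - 1, by omega⟩, ⟨n - 1, by omega⟩, ?_⟩⟩
    · rw [h, mul_assoc, ← pow_add]
      congr 2
      omega
    · rw [h, show m + n - 2 - (m - 1 + (n - 1)) = 0 by omega]
      simpa using hC

theorem mem_kernelTensors_of_isPointEval (hm : 0 < m) (hn : 0 < n) {A : model α →L[ℂ] model β}
    {l : ℕ → ℂ} (hl : ∀ i j, B.entry B' A i j = l (i + j)) (h : IsPointEval (m + n - 2) l) :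
    A ∈ kernelTensors α β := by
  obtain ⟨w, hw, C, hC, h⟩ := h.exists_norm_le
  refine (B.mem_kernelTensors_iff B' hm hn A).mpr ⟨w, hw, C, hC, h.imp ?_ ?_⟩
  · intro h i j
    rw [hl, h _ (by omega)]
  · intro h i j
    rw [hl, h _ (by omega)]

theorem rankOneToeplitz_subset (B : BlaschkeData α m) (B' : BlaschkeData β n)
    (hm : 0 < m) (hn : 0 < n) (h : m * n ≤ 2 ∨ (1 < m ∧ 1 < n)) :
    rankOneToeplitz α β ⊆ kernelTensors α β := by
  rintro A ⟨hA, hrank⟩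
  obtain ⟨l, hl⟩ := (B.mem_asymTruncToeplitz_iff B' A).mp hA
  obtain ⟨⟨x, y, hxy⟩, i, j, hij⟩ := (B.finrank_range_eq_one_iff B' A).mp hrank
  refine B.mem_kernelTensors_of_isPointEval B' hm hn hl ?_
  by_cases hmn : 1 < m ∧ 1 < n
  · refine isPointEval_of_hankel hmn.1 hmn.2 (x := x) (y := y) (fun i j hi hj => ?_)
      ⟨i, i.2, j, j.2, ?_⟩
    · exact (hl ⟨i, hi⟩ ⟨j, hj⟩).symm.trans (hxy ⟨i, hi⟩ ⟨j, hj⟩)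
    · rwa [← hxy]
  · have hle := h.resolve_right hmn
    have hN : m + n - 2 ≤ 1 := by
      rcases not_and_or.mp hmn with h1 | h1
      · obtain rfl : m = 1 := by omega
        omega
      · obtain rfl : n = 1 := by omega
        omega
    refine isPointEval_of_le_one hN ⟨i + j, by omega, ?_⟩
    rwa [← hl]

/-- In the remaining cases, the matrix whose only nonzero entry is the one next to the first
one gives an operator of rank one which is not a kernel tensor. -/
theorem exists_mem_rankOneToeplitz_notMem (B : BlaschkeData α m) (B' : BlaschkeData β n)
    (hm : 0 < m) (hn : 0 < n) (hmn : 2 < m * n)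
    (h : ¬(1 < m ∧ 1 < n)) : ∃ A ∈ rankOneToeplitz α β, A ∉ kernelTensors α β := by
  obtain ⟨A, hA, hl⟩ := B.exists_mem_asymTruncToeplitz B' (fun k => if k = 1 then 1 else 0)
  have hcases : (m = 1 ∧ 3 ≤ n) ∨ (n = 1 ∧ 3 ≤ m) := by
    rcases not_and_or.mp h with h1 | h1
    · obtain rfl : m = 1 := by omega
      omega
    · obtain rfl : n = 1 := by omega
      omega
  refine ⟨A, ⟨hA, (B.finrank_range_eq_one_iff B' A).mpr ?_⟩, ?_⟩
  · rcases hcases with ⟨rfl, h3⟩ | ⟨rfl, h3⟩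
    · refine ⟨⟨fun _ => 1, fun j => if j = 1 then 1 else 0, fun i j => ?_⟩, 0, ⟨1, by omega⟩, ?_⟩
      · rw [hl, one_mul, Fin.val_eq_zero i, zero_add]
      · simp [hl]
    · refine ⟨⟨fun i => if i = 1 then 1 else 0, fun _ => 1, fun i j => ?_⟩, ⟨1, by omega⟩, 0, ?_⟩
      · rw [hl, mul_one, Fin.val_eq_zero j, add_zero]
      · simp [hl]
  · intro hmem
    -- The first entry of a kernel tensor, or its last in the reflected case, is `C ≠ 0`. Here both
    -- vanish, because the last index `m + n - 2` is at least `2`.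
    obtain ⟨w, hw, C, hC, h | h⟩ := (B.mem_kernelTensors_iff B' hm hn A).mp hmem
    · have h1 := h ⟨0, hm⟩ ⟨0, hn⟩
      rw [hl] at h1
      simp [hC.symm] at h1
    · have h1 := h ⟨m - 1, by omega⟩ ⟨n - 1, by omega⟩
      rw [hl, show m + n - 2 - (m - 1 + (n - 1)) = 0 by omega, if_neg (by dsimp only; omega)] at h1
      simp [hC.symm] at h1

end BlaschkeData

theorem IsFiniteBlaschkeProduct.exists_data {α : ℂ → ℂ} {m : ℕ}
    (h : IsFiniteBlaschkeProduct α m) : Nonempty (BlaschkeData α m) := by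
  obtain ⟨c, a, hc, ha, h⟩ := h
  exact ⟨⟨c, a, hc, ha, h⟩⟩

end ModelSpace

end

theorem mainTheorem6 (α β : ℂ → ℂ) (m n : ℕ) (hm : 0 < m) (hn : 0 < n)
    (hα : ModelSpace.IsFiniteBlaschkeProduct α m)
    (hβ : ModelSpace.IsFiniteBlaschkeProduct β n) :
    ModelSpace.rankOneToeplitz α β = ModelSpace.kernelTensors α β ↔
      (m * n ≤ 2 ∨ (1 < m ∧ 1 < n)) := by
  obtain ⟨B⟩ := hα.exists_data
  obtain ⟨B'⟩ := hβ.exists_data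
  constructor
  · intro h
    by_contra hmn
    rw [not_or, not_le] at hmn
    obtain ⟨A, hA, hA'⟩ := B.exists_mem_rankOneToeplitz_notMem B' hm hn hmn.1 hmn.2
    exact hA' (h ▸ hA)
  · intro h
    exact (B.rankOneToeplitz_subset B' hm hn h).antisymm (B.kernelTensors_subset B' hm hn)
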